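/- Let $\mathfrak A$ be a unital $C^*$-algebra, $\theta,\alpha\in\mathrm{Aut}(\mathfrak A)$, and $u\in\mathfrak A$ a unitary with $u\,\alpha(\theta(a))=\theta(\alpha(a))\,u$ for all $a\in\mathfrak A$. Let $\mathfrak A\rtimes_\alpha\mathbb Z$ be the (maximal) $C^*$-crossed product, generated by $\mathfrak A$ and a unitary $V$ with $VaV^*=\alpha(a)$, let $\Phi_{\theta,u}$ be its $*$-automorphism with $\Phi_{\theta,u}(a)=\theta(a)$ for $a\in\mathfrak A$ and $\Phi_{\theta,u}(V)=uV$, and let $E(x)=\frac1{2\pi}\int_0^{2\pi}\rho_{e^{it}}(x)\,dt$ be the canonical conditional expectation onto $\mathfrak A$, where $\rho_z(a)=a$, $\rho_z(V)=zV$. Let $\omega_o$ be a $\theta$-invariant state of $\mathfrak A$ and $\omega:=\omega_o\circ E$, which is a $\Phi_{\theta,u}$-invariant state. For a state $\varphi$ invariant under an automorphism $\Phi$, let $(\mathcal H_\varphi,\pi_\varphi,\xi_\varphi)$ be its GNS representation, and let $V_{\varphi,\Phi}$ be the unitary on $\mathcal H_\varphi$ with $V_{\varphi,\Phi}\pi_\varphi(a)\xi_\varphi=\pi_\varphi(\Phi(a))\xi_\varphi$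 for all $a$. For a bounded operator $T$, let $E_1^{T}$ be the orthogonal projection onto $\{\eta: T\eta=\eta\}$. Call $\varphi$ (or the system) weakly clustering if $\lim_{n\to\infty}\frac1n\sum_{k=0}^{n-1}\varphi(a\,\Phi^k(b))=\varphi(a)\varphi(b)$ for all $a,b$. Identify $\mathcal H_{\omega_o}$ with the closed subspace $\overline{\pi_\omega(\mathfrak A)\xi_\omega}$ of $\mathcal H_\omega$ through the isometry $J\pi_{\omega_o}(a)\xi_{\omega_o}=\pi_\omega(a)\xi_\omega$, so that an operator $T$ on $\mathcal H_{\omega_o}$ is read on $\mathcal H_\omega$ as $JTJ^*$. Finally, put $u_0=1$, $u_n=u\,\alpha(u)\cdots\alpha^{n-1}(u)$ for $n\ge1$, and $u_n=\alpha^{-1}(u^*)\alpha^{-2}(u^*)\cdots\alpha^{n}(u^*)$ for $n<0$. Then the following are equivalent: (i) $E_1^{V_{\omega_o,\theta}}=E_1^{V_{\omega,\Phi_{\theta,u}}}$, that is, $J\,E_1^{V_{\omega_o,\theta}}J^*=E_1^{V_{\omega,\Phi_{\theta,u}}}$; (ii) for every $n\in\mathbb Z\smallsetminus\{0\}$, the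 only $\eta\in\mathcal H_{\omega_o}$ with $\pi_{\omega_o}(\alpha^{-n}(u_n))V_{\omega_o,\theta}\,\eta=\eta$ is $\eta=0$. Consequently, if $(\mathfrak A,\theta,\omega_o)$ is weakly clustering, then $(\mathfrak A\rtimes_\alpha\mathbb Z,\Phi_{\theta,u},\omega)$ is weakly clustering if and only if (ii) holds. -/

import Mathlib

open scoped ComplexOrder

universe u v

noncomputable section

open scoped ENNReal CStarAlgebra

namespace SkewProduct

section GNS

variable {A : Type u} {B : Type v} [CStarAlgebra A] [PartialOrder A] [StarOrderedRing A]
  [CStarAlgebra B] [PartialOrder B] [StarOrderedRing B]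

/-- The cyclic vector of the GNS representation of `f`: the class of the identity. -/
def cyclicVector (f : A →ₚ[ℂ] ℂ) : f.GNS := ((f.toPreGNS 1 : f.PreGNS) : f.GNS)

/-- A unital `*`-homomorphism `j` with `g ∘ j = f` induces an isometry `a ↦ j a` of pre-GNS spaces. -/
def preGNSMap (f : A →ₚ[ℂ] ℂ) (g : B →ₚ[ℂ] ℂ) (j : A →⋆ₐ[ℂ] B) (h : ∀ a, g (j a) = f a) :
    f.PreGNS →L[ℂ] g.PreGNS :=
  LinearMap.mkContinuous
    (g.toPreGNS.toLinearMap ∘ₗ j.toAlgHom.toLinearMap ∘ₗ f.ofPreGNS.toLinearMap) 1 (fun x => by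
      have h1 : g (star (j (f.ofPreGNS x)) * j (f.ofPreGNS x))
          = f (star (f.ofPreGNS x) * f.ofPreGNS x) := by
        rw [← map_star, ← map_mul, h]
      rw [one_mul, PositiveLinearMap.preGNS_norm_def, PositiveLinearMap.preGNS_norm_def]
      simp [h1])

/-- The map of GNS Hilbert spaces `π_f(a) ξ_f ↦ π_g(j a) ξ_g`. -/
def gnsMap (f : A →ₚ[ℂ] ℂ) (g : B →ₚ[ℂ] ℂ) (j : A →⋆ₐ[ℂ] B) (h : ∀ a, g (j a) = f a) :
    f.GNS →L[ℂ] g.GNS :=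
  (preGNSMap f g j h).completion

theorem gnsStarAlgHom_cyclicVector (f : A →ₚ[ℂ] ℂ) (a : A) :
    f.gnsStarAlgHom a (cyclicVector f) = ((f.toPreGNS a : f.PreGNS) : f.GNS) := by
  change f.gnsNonUnitalStarAlgHom a ((f.toPreGNS 1 : f.PreGNS) : f.GNS) = _
  rw [PositiveLinearMap.gnsNonUnitalStarAlgHom_apply_coe]
  simp 

theorem gnsMap_apply (f : A →ₚ[ℂ] ℂ) (g : B →ₚ[ℂ] ℂ) (j : A →⋆ₐ[ℂ] B)
    (h : ∀ a, g (j a) = f a) (a : A) :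
    gnsMap f g j h (f.gnsStarAlgHom a (cyclicVector f))
      = g.gnsStarAlgHom (j a) (cyclicVector g) := by
  rw [gnsStarAlgHom_cyclicVector, gnsStarAlgHom_cyclicVector, gnsMap,
    ContinuousLinearMap.completion_apply_coe]
  rfl

end GNS

section CrossedProductDef
variable {A : Type u} [CStarAlgebra A]

/-- A covariant representation `(π, U)` of `(A, α)` on a nonzero Hilbert space: `U π(a) U* = π(α a)`.
Hilbert spaces in the universe of `A` suffice, as every representation of the `*`-algebra
generated by `A` and `V` is a direct sum of cyclic ones, which fit in that universe. -/
structure CovariantRep (α : A ≃⋆ₐ[ℂ] A) where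
  H : Type u
  [normed : NormedAddCommGroup H]
  [inner : InnerProductSpace ℂ H]
  [complete : CompleteSpace H]
  [nontrivial : Nontrivial H]
  π : A →⋆ₐ[ℂ] (H →L[ℂ] H)
  U : unitary (H →L[ℂ] H)
  covariant : ∀ a, (U : H →L[ℂ] H) * π a = π (α a) * (U : H →L[ℂ] H)

attribute [instance] CovariantRep.normed CovariantRep.inner CovariantRep.complete
  CovariantRep.nontrivial

variable (α : A ≃⋆ₐ[ℂ] A)

/-- The `ℓ^∞`-product, over all covariant representations, of the algebras of bounded operators. -/
abbrev BoundedFamily : Type (u + 1) := lp (fun r : CovariantRep α => r.H →L[ℂ] r.H) ∞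

instance : CStarAlgebra (BoundedFamily α) where

/-- `a ↦ (π(a))_{(π, U)}`. -/
def univι : A →⋆ₐ[ℂ] BoundedFamily α where
  toFun a := ⟨fun r => r.π a,
    memℓp_infty ⟨‖a‖, by rintro _ ⟨r, rfl⟩; exact NonUnitalStarAlgHom.norm_apply_le r.π a⟩⟩
  map_one' := by ext1; funext r; exact map_one r.π
  map_mul' a b := by ext1; funext r; exact map_mul r.π a b
  map_zero' := by ext1; funext r; exact map_zero r.π
  map_add' a b := by ext1; funext r; exact map_add r.π a b
  commutes' c := by ext1; funext r; exact AlgHomClass.commutes r.π c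
  map_star' a := by ext1; funext r; exact map_star r.π a

/-- The unitary `(U)_{(π, U)}`. -/
def univV : unitary (BoundedFamily α) :=
  ⟨⟨fun r => (r.U : r.H →L[ℂ] r.H),
    memℓp_infty ⟨1, by rintro _ ⟨r, rfl⟩; exact (CStarRing.norm_coe_unitary r.U).le⟩⟩, by
    rw [Unitary.mem_iff]
    constructor
    · ext1; funext r; exact Unitary.coe_star_mul_self r.U
    · ext1; funext r; exact Unitary.coe_mul_star_self r.U⟩

/-- The norm closure of the `*`-algebra generated by the copy of `A` and by the unitary `V`, in the
universal covariant representation. -/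
def crossedSubalgebra : StarSubalgebra ℂ (BoundedFamily α) :=
  (StarAlgebra.adjoin ℂ (Set.range (univι α) ∪ {(univV α : BoundedFamily α)})).topologicalClosure

/-- The `C*`-crossed product `A ⋊_α ℤ`: the completion of the `*`-algebra of finite sums `∑ a_k V^k`,
with `V a V* = α(a)`, in the maximal norm `sup ‖π(x)‖` over all covariant representations. -/
def CrossedProduct : Type (u + 1) := crossedSubalgebra α

instance : CStarAlgebra (CrossedProduct α) :=
  haveI : IsClosed (crossedSubalgebra α : Set (BoundedFamily α)) :=
    StarSubalgebra.isClosed_topologicalClosure _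
  inferInstanceAs (CStarAlgebra (crossedSubalgebra α))

instance : PartialOrder (CrossedProduct α) := CStarAlgebra.spectralOrder _
instance : StarOrderedRing (CrossedProduct α) := CStarAlgebra.spectralOrderedRing _

namespace CrossedProduct

variable {α}

/-- The representation of `A ⋊_α ℤ` given by a covariant representation. -/
def eval (r : CovariantRep α) : CrossedProduct α →⋆ₐ[ℂ] (r.H →L[ℂ] r.H) where
  toFun x := (x.1 : BoundedFamily α) r
  map_one' := rfl
  map_mul' _ _ := rfl
  map_zero' := rfl
  map_add' _ _ := rfl
  commutes' _ := rfl
  map_star' _ := rfl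

theorem ext_eval {x y : CrossedProduct α} (h : ∀ r, eval r x = eval r y) : x = y :=
  Subtype.ext (lp.ext (funext h))

variable (α)

/-- The canonical embedding `A → A ⋊_α ℤ`. -/
def ι : A →⋆ₐ[ℂ] CrossedProduct α :=
  (univι α).codRestrict (crossedSubalgebra α) fun a =>
    StarSubalgebra.le_topologicalClosure _
      (StarAlgebra.subset_adjoin ℂ _ (Or.inl ⟨a, rfl⟩))

/-- The canonical unitary `V` of `A ⋊_α ℤ`, with `V a V* = α(a)`. -/
def V : unitary (CrossedProduct α) :=
  ⟨⟨univV α, StarSubalgebra.le_topologicalClosure _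
      (StarAlgebra.subset_adjoin ℂ _ (Or.inr rfl))⟩,
    Unitary.mem_iff.2 ⟨Subtype.ext (Unitary.coe_star_mul_self (univV α)),
      Subtype.ext (Unitary.coe_mul_star_self (univV α))⟩⟩

variable {α}

theorem eval_ι (r : CovariantRep α) (a : A) : eval r (ι α a) = r.π a := rfl

theorem eval_V (r : CovariantRep α) : eval r (V α : CrossedProduct α) = (r.U : r.H →L[ℂ] r.H) := rfl

theorem V_mul_ι (a : A) :
    (V α : CrossedProduct α) * ι α a = ι α (α a) * (V α : CrossedProduct α) :=
  ext_eval fun r => r.covariant a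

theorem ι_mul_V_zpow (n : ℤ) (a : A) :
    ((V α ^ n : unitary (CrossedProduct α)) : CrossedProduct α) * ι α a
      = ι α ((α ^ n) a) * ((V α ^ n : unitary (CrossedProduct α)) : CrossedProduct α) := by
  induction n generalizing a with
  | zero => simp
  | succ n ih =>
    rw [zpow_add_one, zpow_add_one, Submonoid.coe_mul, mul_assoc, V_mul_ι, ← mul_assoc, ih]
    simp [mul_assoc]
  | pred n ih =>
    have h : ((V α)⁻¹ : unitary (CrossedProduct α)).1 * ι α a
        = ι α (α⁻¹ a) * ((V α)⁻¹ : unitary (CrossedProduct α)).1 := by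
      have h1 := V_mul_ι (α := α) (α⁻¹ a)
      rw [show α (α⁻¹ a) = a from α.apply_symm_apply a] at h1
      have h2 := congrArg (fun x => ((V α)⁻¹ : unitary (CrossedProduct α)).1 * x
        * ((V α)⁻¹ : unitary (CrossedProduct α)).1) h1
      simp only [mul_assoc] at h2
      rw [← Submonoid.coe_mul, mul_inv_cancel, Submonoid.coe_one, mul_one, ← mul_assoc _ (V α).1,
        ← Submonoid.coe_mul, inv_mul_cancel, Submonoid.coe_one, one_mul] at h2
      exact h2.symm
    rw [zpow_sub_one, zpow_sub_one, Submonoid.coe_mul, mul_assoc, h, ← mul_assoc, ih]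
    simp [mul_assoc]

/-- The finite sums `∑ a_k V^k` are dense. -/
theorem span_dense (x : CrossedProduct α) : x ∈ (Submodule.span ℂ (Set.range fun p : A × ℤ =>
      ι α p.1 * ((V α ^ p.2 : unitary (CrossedProduct α)) : CrossedProduct α))).topologicalClosure := by
  set S : Submodule ℂ (CrossedProduct α) := Submodule.span ℂ (Set.range fun p : A × ℤ =>
      ι α p.1 * ((V α ^ p.2 : unitary (CrossedProduct α)) : CrossedProduct α)) with hS
  have gen : ∀ (a : A) (n : ℤ), ι α a * ((V α ^ n : unitary (CrossedProduct α)) : CrossedProduct α) ∈ S :=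
    fun a n => Submodule.subset_span ⟨(a, n), rfl⟩
  have key : ∀ y : BoundedFamily α,
      y ∈ StarAlgebra.adjoin ℂ (Set.range (univι α) ∪ {(univV α : BoundedFamily α)}) →
      ∃ z : CrossedProduct α, z ∈ S ∧ z.1 = y := by
    intro y hy
    induction hy using StarAlgebra.adjoin_induction with
    | mem y hy =>
      rcases hy with ⟨a, rfl⟩ | rfl
      · exact ⟨ι α a, by simpa using gen a 0, rfl⟩
      · exact ⟨V α, by simpa using gen 1 1, rfl⟩
    | algebraMap c =>
      refine ⟨algebraMap ℂ _ c, ?_, rfl⟩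
      have := gen (algebraMap ℂ A c) 0
      rwa [AlgHomClass.commutes, zpow_zero, Submonoid.coe_one, mul_one] at this
    | add y z _ _ hy hz =>
      obtain ⟨y', hy', rfl⟩ := hy
      obtain ⟨z', hz', rfl⟩ := hz
      exact ⟨y' + z', add_mem hy' hz', rfl⟩
    | mul y z h1 h2 hy hz =>
      obtain ⟨y', hy', rfl⟩ := hy
      obtain ⟨z', hz', rfl⟩ := hz
      clear h1 h2
      refine ⟨y' * z', ?_, rfl⟩
      induction hy', hz' using Submodule.span_induction₂ with
      | mem_mem p q hp hq =>
        obtain ⟨⟨a, n⟩, rfl⟩ := hp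
        obtain ⟨⟨b, m⟩, rfl⟩ := hq
        have := gen (a * (α ^ n) b) (n + m)
        rw [map_mul, zpow_add, Submonoid.coe_mul, mul_assoc, ← mul_assoc (ι α _) (V α ^ n).1,
          ← ι_mul_V_zpow] at this
        simpa only [mul_assoc] using this
      | zero_left => simp
      | zero_right => simp
      | add_left => rw [add_mul]; exact add_mem ‹_› ‹_›
      | add_right => rw [mul_add]; exact add_mem ‹_› ‹_›
      | smul_left => rw [smul_mul_assoc]; exact S.smul_mem _ ‹_›
      | smul_right => rw [mul_smul_comm]; exact S.smul_mem _ ‹_›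
    | star y h1 hy =>
      obtain ⟨y', hy', rfl⟩ := hy
      clear h1
      refine ⟨star y', ?_, rfl⟩
      induction hy' using Submodule.span_induction with
      | mem p hp =>
        obtain ⟨⟨a, n⟩, rfl⟩ := hp
        have := gen ((α ^ (-n)) (star a)) (-n)
        rw [← ι_mul_V_zpow] at this
        simpa [star_mul, zpow_neg, ← Unitary.coe_star, Unitary.star_eq_inv, map_star] using this
      | zero => simp
      | add => rw [star_add]; exact add_mem ‹_› ‹_›
      | smul => rw [star_smul]; exact S.smul_mem _ ‹_›
  have hx := x.2
  rw [← SetLike.mem_coe, Submodule.topologicalClosure_coe, Metric.mem_closure_iff]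
  intro ε hε
  obtain ⟨y, hy, hd⟩ := Metric.mem_closure_iff.1 hx ε hε
  obtain ⟨z, hz, rfl⟩ := key y hy
  exact ⟨z, hz, hd⟩

theorem induction {p : CrossedProduct α → Prop} (closed : IsClosed {x | p x})
    (zero : p 0) (add : ∀ x y, p x → p y → p (x + y)) (smul : ∀ (c : ℂ) x, p x → p (c • x))
    (gen : ∀ a (n : ℤ), p (ι α a * ((V α ^ n : unitary (CrossedProduct α)) : CrossedProduct α)))
    (x : CrossedProduct α) : p x := by
  let S : Submodule ℂ (CrossedProduct α) :=
    { carrier := {x | p x}, add_mem' := fun {x y} => add x y, zero_mem' := zero,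
      smul_mem' := fun c x => smul c x }
  have : (Submodule.span ℂ (Set.range fun p : A × ℤ =>
      ι α p.1 * ((V α ^ p.2 : unitary (CrossedProduct α)) : CrossedProduct α))).topologicalClosure
      ≤ S := by
    refine Submodule.topologicalClosure_minimal _ (Submodule.span_le.2 ?_) closed
    rintro _ ⟨⟨a, n⟩, rfl⟩
    exact gen a n
  exact this (span_dense x)

end CrossedProduct
end CrossedProductDef

section Automorphisms
variable {A : Type u} [CStarAlgebra A] {α : A ≃⋆ₐ[ℂ] A}

/-- The covariant representation `(π ∘ θ, π(w) U)`. -/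
def CovariantRep.twist (θ : A →⋆ₐ[ℂ] A) (w : unitary A)
    (h : ∀ a, (w : A) * α (θ a) = θ (α a) * w) (r : CovariantRep α) : CovariantRep α where
  H := r.H
  π := r.π.comp θ
  U := ⟨r.π w, Unitary.map_mem r.π w.2⟩ * r.U
  covariant a := by
    simp only [Submonoid.coe_mul, StarAlgHom.comp_apply]
    rw [mul_assoc, r.covariant, ← mul_assoc, ← map_mul, h, map_mul, mul_assoc]

namespace CrossedProduct

/-- Reindexing a bounded family along `(π, U) ↦ (π ∘ θ, π(w) U)`. -/
def familyTwist (θ : A →⋆ₐ[ℂ] A) (w : unitary A)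
    (h : ∀ a, (w : A) * α (θ a) = θ (α a) * w) : BoundedFamily α →⋆ₐ[ℂ] BoundedFamily α where
  toFun f := ⟨fun r => f (r.twist θ w h), memℓp_infty ⟨‖f‖, by
    rintro _ ⟨r, rfl⟩; exact lp.norm_apply_le_norm ENNReal.top_ne_zero f (r.twist θ w h)⟩⟩
  map_one' := rfl
  map_mul' _ _ := rfl
  map_zero' := rfl
  map_add' _ _ := rfl
  commutes' _ := rfl
  map_star' _ := rfl

theorem familyTwist_mem (θ : A →⋆ₐ[ℂ] A) (w : unitary A)
    (h : ∀ a, (w : A) * α (θ a) = θ (α a) * w) (x : CrossedProduct α) :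
    familyTwist θ w h x.1 ∈ crossedSubalgebra α := by
  have hcont : Continuous (familyTwist θ w h) := map_continuous (familyTwist θ w h)
  have hcl : IsClosed (crossedSubalgebra α : Set (BoundedFamily α)) :=
    StarSubalgebra.isClosed_topologicalClosure _
  refine induction (p := fun x => familyTwist θ w h x.1 ∈ crossedSubalgebra α)
    (hcl.preimage (hcont.comp continuous_subtype_val)) ?_ ?_ ?_ ?_ x
  · exact (crossedSubalgebra α).zero_mem
  · intro x y hx hy
    exact (crossedSubalgebra α).add_mem hx hy
  · intro c x hx
    exact (crossedSubalgebra α).smul_mem hx c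
  · intro a n
    have hι : familyTwist θ w h (ι α a).1 = (ι α (θ a)).1 := rfl
    have hV : familyTwist θ w h (V α).1.1 = (ι α w * (V α).1).1 := rfl
    have hVs : familyTwist θ w h (star (V α).1).1 = (star (ι α w * (V α).1)).1 := rfl
    have h1 : ∀ n : ℤ, familyTwist θ w h (V α ^ n).1.1 ∈ crossedSubalgebra α := by
      intro n
      have hm : ∀ x y : CrossedProduct α, familyTwist θ w h x.1 ∈ crossedSubalgebra α →
          familyTwist θ w h y.1 ∈ crossedSubalgebra α →
          familyTwist θ w h (x * y).1 ∈ crossedSubalgebra α := fun x y hx hy =>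
        (crossedSubalgebra α).mul_mem hx hy
      induction n with
      | zero => rw [zpow_zero]; exact (crossedSubalgebra α).one_mem
      | succ n ih =>
        rw [zpow_add_one]
        exact hm _ _ ih (hV ▸ Subtype.property _)
      | pred n ih =>
        rw [zpow_sub_one]
        exact hm _ _ ih (hVs ▸ Subtype.property _)
    exact (crossedSubalgebra α).mul_mem (hι ▸ Subtype.property _) (h1 n)

/-- The `*`-endomorphism of `A ⋊_α ℤ` with `a ↦ θ(a)` and `V ↦ w V`. -/
def skewEnd (θ : A →⋆ₐ[ℂ] A) (w : unitary A)
    (h : ∀ a, (w : A) * α (θ a) = θ (α a) * w) : CrossedProduct α →⋆ₐ[ℂ] CrossedProduct α where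
  toFun x := ⟨familyTwist θ w h x.1, familyTwist_mem θ w h x⟩
  map_one' := rfl
  map_mul' _ _ := rfl
  map_zero' := rfl
  map_add' _ _ := rfl
  commutes' _ := rfl
  map_star' _ := rfl

theorem skewEnd_ι (θ : A →⋆ₐ[ℂ] A) (w : unitary A)
    (h : ∀ a, (w : A) * α (θ a) = θ (α a) * w) (a : A) :
    skewEnd θ w h (ι α a) = ι α (θ a) := rfl

theorem skewEnd_V (θ : A →⋆ₐ[ℂ] A) (w : unitary A)
    (h : ∀ a, (w : A) * α (θ a) = θ (α a) * w) :
    skewEnd θ w h (V α : CrossedProduct α) = ι α w * (V α : CrossedProduct α) := rfl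

theorem hom_ext {φ ψ : CrossedProduct α →⋆ₐ[ℂ] CrossedProduct α}
    (h1 : ∀ a, φ (ι α a) = ψ (ι α a))
    (h2 : φ (V α : CrossedProduct α) = ψ (V α : CrossedProduct α)) (x : CrossedProduct α) :
    φ x = ψ x := by
  have h3 : φ (star (V α : CrossedProduct α)) = ψ (star (V α : CrossedProduct α)) := by
    rw [map_star, map_star, h2]
  have h4 : ∀ n : ℤ, φ (V α ^ n).1 = ψ (V α ^ n).1 := by
    intro n
    induction n with
    | zero => simp
    | succ n ih => rw [zpow_add_one, Submonoid.coe_mul, map_mul, map_mul, ih, h2]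
    | pred n ih =>
      rw [zpow_sub_one, Submonoid.coe_mul, map_mul, map_mul, ih]
      exact congrArg _ h3
  refine induction (p := fun x => φ x = ψ x)
    (isClosed_eq (map_continuous φ) (map_continuous ψ)) ?_ ?_ ?_ ?_ x
  · simp
  · intro x y hx hy; rw [map_add, map_add, hx, hy]
  · intro c x hx; rw [map_smul, map_smul, hx]
  · intro a n; rw [map_mul, map_mul, h1, h4]

theorem skew_inv_aux {θ : A ≃⋆ₐ[ℂ] A} {w : unitary A}
    (h : ∀ a, (w : A) * α (θ a) = θ (α a) * w) (a : A) :
    θ.symm (star (w : A)) * α (θ.symm a) = θ.symm (α a) * θ.symm (star (w : A)) := by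
  apply EquivLike.injective θ
  have h1 := h (θ.symm a)
  simp only [map_mul, StarAlgEquiv.apply_symm_apply] at h1 ⊢
  have h2 := congrArg (fun x => star (w : A) * x * star (w : A)) h1
  simp only [mul_assoc] at h2
  rw [← mul_assoc, Unitary.star_mul_self_of_mem w.2, one_mul, Unitary.mul_star_self_of_mem w.2,
    mul_one] at h2
  exact h2.symm

/-- The `*`-automorphism `Φ_{θ,w}` of `A ⋊_α ℤ`, with `Φ_{θ,w}(a) = θ(a)` and `Φ_{θ,w}(V) = w V`. -/
def skewAut (θ : A ≃⋆ₐ[ℂ] A) (w : unitary A)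
    (h : ∀ a, (w : A) * α (θ a) = θ (α a) * w) : CrossedProduct α ≃⋆ₐ[ℂ] CrossedProduct α :=
  StarAlgEquiv.ofBijective (skewEnd (θ : A →⋆ₐ[ℂ] A) w h) <| by
    let w' : unitary A := ⟨θ.symm (star (w : A)), Unitary.map_mem θ.symm (star w).2⟩
    let ψ : CrossedProduct α →⋆ₐ[ℂ] CrossedProduct α :=
      skewEnd (θ.symm : A →⋆ₐ[ℂ] A) w' (skew_inv_aux h)
    refine Function.bijective_iff_has_inverse.2 ⟨ψ, fun x => ?_, fun x => ?_⟩
    · refine hom_ext (φ := ψ.comp (skewEnd (θ : A →⋆ₐ[ℂ] A) w h))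
        (ψ := StarAlgHom.id ℂ (CrossedProduct α)) (fun a => ?_) ?_ x
      · exact congrArg (ι α) (θ.symm_apply_apply a)
      · change ψ (ι α w * (V α).1) = (V α).1
        rw [map_mul]
        change ι α (θ.symm w) * (ι α (θ.symm (star (w : A))) * (V α).1) = (V α).1
        rw [← mul_assoc, ← map_mul, ← map_mul, Unitary.mul_star_self_of_mem w.2]
        simp
    · refine hom_ext (φ := (skewEnd (θ : A →⋆ₐ[ℂ] A) w h).comp ψ)
        (ψ := StarAlgHom.id ℂ (CrossedProduct α)) (fun a => ?_) ?_ x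
      · exact congrArg (ι α) (θ.apply_symm_apply a)
      · change skewEnd (θ : A →⋆ₐ[ℂ] A) w h (ι α (θ.symm (star (w : A))) * (V α).1) = (V α).1
        rw [map_mul]
        change ι α (θ (θ.symm (star (w : A)))) * (ι α w * (V α).1) = (V α).1
        rw [θ.apply_symm_apply, ← mul_assoc, ← map_mul, Unitary.star_mul_self_of_mem w.2]
        simp

/-- The scalar unitary `z 1`. -/
def circleUnitary (z : Circle) : unitary A :=
  ⟨(z : ℂ) • 1, by
    rw [Unitary.mem_iff]
    have : (starRingEnd ℂ) (z : ℂ) * z = 1 := by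
      rw [← Complex.normSq_eq_conj_mul_self, Circle.normSq_coe]; simp
    constructor
    · rw [star_smul, star_one, smul_mul_smul_comm, mul_one]
      exact (congrArg (· • (1 : A)) this).trans (one_smul _ _)
    · rw [star_smul, star_one, smul_mul_smul_comm, mul_one, mul_comm]
      exact (congrArg (· • (1 : A)) this).trans (one_smul _ _)⟩

variable (α) in
/-- The gauge automorphism `ρ_z`, with `ρ_z(a) = a` and `ρ_z(V) = z V`. -/
def gauge (z : Circle) : CrossedProduct α →⋆ₐ[ℂ] CrossedProduct α :=
  skewEnd (StarAlgHom.id ℂ A) (circleUnitary z) fun a => by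
    simp [circleUnitary]

theorem gauge_ι (z : Circle) (a : A) : gauge α z (ι α a) = ι α a := rfl

theorem gauge_V (z : Circle) :
    gauge α z (V α : CrossedProduct α) = (z : ℂ) • (V α : CrossedProduct α) := by
  rw [gauge, skewEnd_V]
  simp [circleUnitary]

theorem gauge_zpow (z : Circle) (a : A) (n : ℤ) :
    gauge α z (ι α a * (V α ^ n).1) = ((z ^ n : Circle) : ℂ) • (ι α a * (V α ^ n).1) := by
  rw [map_mul, gauge_ι, ← mul_smul_comm]
  congr 1
  induction n with
  | zero => simp
  | succ n ih =>
    rw [zpow_add_one, zpow_add_one, Submonoid.coe_mul, map_mul, ih, gauge_V, Circle.coe_mul,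
      smul_mul_smul_comm]
  | pred n ih =>
    have : gauge α z ((V α)⁻¹).1 = ((z⁻¹ : Circle) : ℂ) • ((V α)⁻¹).1 := by
      change gauge α z (star (V α).1) = _ • star (V α).1
      rw [map_star, gauge_V, star_smul, Circle.coe_inv_eq_conj]; rfl
    rw [zpow_sub_one, zpow_sub_one, Submonoid.coe_mul, map_mul, ih, this, Circle.coe_mul,
      smul_mul_smul_comm]

theorem gauge_norm_le (z : Circle) (x : CrossedProduct α) : ‖gauge α z x‖ ≤ ‖x‖ :=
  NonUnitalStarAlgHom.norm_apply_le (gauge α z) x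

theorem continuous_gauge (x : CrossedProduct α) : Continuous fun z : Circle => gauge α z x := by
  refine induction (p := fun x => Continuous fun z : Circle => gauge α z x) ?_ ?_ ?_ ?_ ?_ x
  · refine isClosed_of_closure_subset fun x hx => ?_
    refine continuous_of_uniform_approx_of_continuous fun s hs => ?_
    obtain ⟨ε, hε, hs⟩ := Metric.mem_uniformity_dist.1 hs
    obtain ⟨y, hy, hd⟩ := Metric.mem_closure_iff.1 hx ε hε
    refine ⟨fun z => gauge α z y, hy, fun z => hs ?_⟩
    rw [dist_eq_norm, ← map_sub]
    exact (gauge_norm_le z _).trans_lt (by rwa [← dist_eq_norm])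
  · simpa using continuous_const
  · intro x y hx hy; simp only [map_add]; exact Continuous.add hx hy
  · intro c x hx; simp only [map_smul]; exact Continuous.const_smul hx c
  · intro a n
    simp only [gauge_zpow]
    have hc : Continuous fun z : Circle => ((z ^ n : Circle) : ℂ) :=
      continuous_subtype_val.comp (continuous_zpow (G := Circle) n)
    exact hc.smul continuous_const

end CrossedProduct
end Automorphisms

section States
variable {A : Type u} [CStarAlgebra A] [PartialOrder A] [StarOrderedRing A]

theorem norm_cyclicVector_sq (f : A →ₚ[ℂ] ℂ) : ((‖cyclicVector f‖ ^ 2 : ℝ) : ℂ) = f 1 := by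
  rw [cyclicVector, UniformSpace.Completion.norm_coe]
  push_cast
  rw [PositiveLinearMap.preGNS_norm_sq]
  simp

/-- States separate the positive elements from `0`. -/
theorem exists_state_ne_zero {b : A} (hb : 0 ≤ b) (hb0 : b ≠ 0) :
    ∃ f : A →ₚ[ℂ] ℂ, f b ≠ 0 ∧ f 1 = 1 := by
  have : Nontrivial A := ⟨b, 0, hb0⟩
  obtain ⟨g, hg1, hgb⟩ := exists_dual_vector' ℂ (1 + b)
  have hnorm : ‖1 + b‖ = 1 + ‖b‖ := by
    refine le_antisymm ((norm_add_le _ _).trans (by simp)) ?_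
    have h1 : 1 + b ≤ algebraMap ℝ A ‖1 + b‖ :=
      IsSelfAdjoint.le_algebraMap_norm_self (.of_nonneg (add_nonneg zero_le_one hb))
    have h3 : b ≤ algebraMap ℝ A (‖1 + b‖ - 1) := by
      rw [map_sub, map_one]; exact le_sub_iff_add_le'.2 h1
    have h4 : 0 ≤ ‖1 + b‖ - 1 := by
      have h5 : (1 : A) ≤ algebraMap ℝ A ‖1 + b‖ := le_trans (le_add_of_nonneg_right hb) h1
      have h6 := (CStarAlgebra.norm_le_iff_le_algebraMap (1 : A) (norm_nonneg (1 + b))).2 h5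
      rw [norm_one] at h6; linarith
    have := (CStarAlgebra.norm_le_iff_le_algebraMap b h4 hb).2 h3
    linarith
  have hle : ∀ x, ‖g x‖ ≤ ‖x‖ := fun x => by simpa [hg1] using g.le_opNorm x
  have hsum : g 1 + g b = ((1 + ‖b‖ : ℝ) : ℂ) := by
    rw [← map_add, hgb, hnorm]; rfl
  have hre := congrArg Complex.re hsum
  simp only [Complex.add_re, Complex.ofReal_re] at hre
  have h1le : (g 1).re ≤ 1 := (Complex.re_le_norm _).trans ((hle 1).trans (by simp))
  have hble : (g b).re ≤ ‖b‖ := (Complex.re_le_norm _).trans (hle b)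
  have hg1re : (g 1).re = 1 := by linarith
  have hgbre : (g b).re = ‖b‖ := by linarith
  have hgone : g 1 = 1 := by
    have h7 : ‖g 1‖ ≤ 1 := (hle 1).trans (by simp)
    have h8 : Complex.normSq (g 1) ≤ 1 := by
      rw [Complex.normSq_eq_norm_sq]; nlinarith [norm_nonneg (g 1)]
    rw [Complex.normSq_apply, hg1re] at h8
    apply Complex.ext
    · simp [hg1re]
    · simp; nlinarith [mul_self_nonneg (g 1).im]
  have him : ∀ x : A, IsSelfAdjoint x → (g x).im = 0 := by
    intro x hx
    by_contra hne
    have key : ∀ t : ℝ, ((g x).im + t) ^ 2 ≤ ‖x‖ ^ 2 + t ^ 2 := by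
      intro t
      have h9 : ‖x + (Complex.I * t) • (1 : A)‖ ^ 2 ≤ ‖x‖ ^ 2 + t ^ 2 := by
        rw [sq, ← CStarRing.norm_star_mul_self]
        have : star (x + (Complex.I * t) • (1 : A)) * (x + (Complex.I * t) • (1 : A))
            = x * x + ((t ^ 2 : ℝ) : ℂ) • (1 : A) := by
          rw [star_add, star_smul, star_one, hx.star_eq]
          have e1 : star (Complex.I * (t : ℂ)) = -(Complex.I * t) := by simp
          rw [e1, add_mul, mul_add, mul_add]
          simp only [smul_mul_assoc, mul_smul_comm, one_mul, mul_one, neg_smul,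
            neg_mul]
          have e2 : Complex.I * (t : ℂ) * (Complex.I * t) = -((t ^ 2 : ℝ) : ℂ) := by
            push_cast
            linear_combination (t : ℂ) ^ 2 * Complex.I_mul_I
          rw [smul_neg, smul_smul, e2, neg_smul, neg_neg]
          abel
        rw [this]
        refine (norm_add_le _ _).trans (add_le_add ((norm_mul_le _ _).trans (by rw [sq])) ?_)
        rw [norm_smul, norm_one, mul_one, Complex.norm_real, Real.norm_of_nonneg (sq_nonneg t)]
      have h10 : g (x + (Complex.I * t) • (1 : A)) = g x + Complex.I * t := by
        rw [map_add, map_smul, hgone]; simp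
      have h11 := hle (x + (Complex.I * t) • (1 : A))
      rw [h10] at h11
      have h12 : |(g x).im + t| ≤ ‖g x + Complex.I * t‖ := by
        simpa using Complex.abs_im_le_norm (g x + Complex.I * t)
      have h13 := pow_le_pow_left₀ (abs_nonneg _) (h12.trans h11) 2
      rw [sq_abs] at h13
      exact h13.trans h9
    have h14 := key ((‖x‖ ^ 2) / (g x).im)
    have h15 : (g x).im * (‖x‖ ^ 2 / (g x).im) = ‖x‖ ^ 2 := by field_simp
    have h16 : 0 < (g x).im ^ 2 := by positivity
    nlinarith [sq_nonneg ‖x‖]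
  have hpos : ∀ x : A, 0 ≤ x → 0 ≤ g x := by
    intro x hx
    have hsa : IsSelfAdjoint x := .of_nonneg hx
    rw [Complex.nonneg_iff]
    refine ⟨?_, (him x hsa).symm⟩
    have h17 : ‖algebraMap ℝ A ‖x‖ - x‖ ≤ ‖x‖ := by
      refine (CStarAlgebra.norm_le_iff_le_algebraMap _ (norm_nonneg x) ?_).2 ?_
      · exact sub_nonneg.2 (IsSelfAdjoint.le_algebraMap_norm_self hsa)
      · exact sub_le_self _ hx
    have h18 : g (algebraMap ℝ A ‖x‖ - x) = (‖x‖ : ℂ) - g x := by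
      rw [map_sub, Algebra.algebraMap_eq_smul_one, ← Complex.coe_smul, map_smul, hgone]; simp
    have h19 := (Complex.re_le_norm _).trans ((hle _).trans h17)
    rw [h18] at h19
    simp at h19
    exact h19
  refine ⟨PositiveLinearMap.mk₀ g.toLinearMap hpos, ?_, hgone⟩
  change g b ≠ 0
  intro h0
  rw [h0] at hgbre
  exact hb0 (norm_eq_zero.1 hgbre.symm)

end States

section Vector
variable {A : Type u} [CStarAlgebra A] {α : A ≃⋆ₐ[ℂ] A}
namespace CrossedProduct

/-- The functional `x ↦ ⟨v, x_r v⟩`. -/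
def vectorFunctional (r : CovariantRep α) (v : r.H) : CrossedProduct α →ₗ[ℂ] ℂ where
  toFun x := inner ℂ v (eval r x v)
  map_add' x y := by
    rw [map_add]
    exact inner_add_right v (eval r x v) (eval r y v)
  map_smul' c x := by
    rw [map_smul]
    exact inner_smul_right v (eval r x v) c

theorem vectorFunctional_apply (r : CovariantRep α) (v : r.H) (x : CrossedProduct α) :
    vectorFunctional r v x = inner ℂ v (eval r x v) := rfl

theorem continuous_vectorFunctional (r : CovariantRep α) (v : r.H) :
    Continuous (vectorFunctional r v) := by
  have hc : Continuous (eval r) := map_continuous _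
  exact continuous_const.inner (hc.clm_apply continuous_const)

theorem vectorFunctional_nonneg (r : CovariantRep α) (v : r.H) {x : CrossedProduct α}
    (hx : 0 ≤ x) : 0 ≤ vectorFunctional r v x := by
  obtain ⟨y, rfl⟩ := CStarAlgebra.nonneg_iff_eq_star_mul_self.1 hx
  rw [vectorFunctional_apply, map_mul, map_star]
  change 0 ≤ inner ℂ v (star (eval r y) (eval r y v))
  rw [ContinuousLinearMap.star_eq_adjoint, ContinuousLinearMap.adjoint_inner_right,
    inner_self_eq_norm_sq_to_K]
  have h : (0 : ℂ) ≤ ((‖eval r y v‖ ^ 2 : ℝ) : ℂ) := by exact_mod_cast sq_nonneg ‖eval r y v‖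
  rwa [Complex.ofReal_pow] at h

end CrossedProduct
end Vector

section Regular
variable {A : Type u} [CStarAlgebra A] [PartialOrder A] [StarOrderedRing A]

/-- `ℓ²(ℤ; H_f)`. -/
abbrev RegularSpace (f : A →ₚ[ℂ] ℂ) : Type u := lp (fun _ : ℤ => f.GNS) 2

theorem memℓp_comp_equiv {E : Type u} [NormedAddCommGroup E] (e : ℤ ≃ ℤ)
    {x : ℤ → E} (hx : Memℓp x 2) : Memℓp (fun k => x (e k)) 2 := by
  rw [memℓp_gen_iff (by norm_num)] at hx ⊢
  exact (e.summable_iff (f := fun k => ‖x k‖ ^ (2 : ℝ≥0∞).toReal)).2 hx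

/-- The bilateral shift `(Uξ)(k) = ξ(k - 1)`. -/
def shift (f : A →ₚ[ℂ] ℂ) : RegularSpace f ≃ₗᵢ[ℂ] RegularSpace f where
  toFun x := ⟨fun k => x (k - 1), memℓp_comp_equiv (Equiv.subRight 1) x.2⟩
  invFun x := ⟨fun k => x (k + 1), memℓp_comp_equiv (Equiv.addRight 1) x.2⟩
  map_add' _ _ := rfl
  map_smul' _ _ := rfl
  left_inv x := by ext k; simp
  right_inv x := by ext k; simp
  norm_map' x := by
    rw [lp.norm_eq_tsum_rpow (by norm_num), lp.norm_eq_tsum_rpow (by norm_num)]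
    congr 1
    exact (Equiv.subRight (1 : ℤ)).tsum_eq fun k => ‖x k‖ ^ (2 : ℝ≥0∞).toReal

theorem gns_norm_le (f : A →ₚ[ℂ] ℂ) (α : A ≃⋆ₐ[ℂ] A) (a : A) (k : ℤ) :
    ‖f.gnsStarAlgHom ((α ^ (-k)) a)‖ ≤ ‖a‖ :=
  (NonUnitalStarAlgHom.norm_apply_le f.gnsStarAlgHom _).trans
    (NonUnitalStarAlgHom.norm_apply_le (α ^ (-k)) a)

/-- `(π(a)ξ)(k) = π_f(α^{-k}(a)) ξ(k)`. -/
def regularHom (f : A →ₚ[ℂ] ℂ) (α : A ≃⋆ₐ[ℂ] A) :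
    A →⋆ₐ[ℂ] (RegularSpace f →L[ℂ] RegularSpace f) where
  toFun a := lp.mapCLM 2 (fun k => f.gnsStarAlgHom ((α ^ (-k)) a)) (norm_nonneg a)
    (gns_norm_le f α a)
  map_one' := by ext x k; simp
  map_mul' a b := by ext x k; simp
  map_zero' := by ext x k; simp
  map_add' a b := by ext x k; simp
  commutes' c := by
    ext x k
    simp [Algebra.algebraMap_eq_smul_one]
  map_star' a := by
    refine (ContinuousLinearMap.eq_adjoint_iff _ _).mpr fun x y => ?_
    rw [lp.inner_eq_tsum, lp.inner_eq_tsum]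
    refine tsum_congr fun k => ?_
    change inner ℂ (f.gnsStarAlgHom ((α ^ (-k)) (star a)) (x k)) (y k)
      = inner ℂ (x k) (f.gnsStarAlgHom ((α ^ (-k)) a) (y k))
    rw [map_star, map_star, ContinuousLinearMap.star_eq_adjoint,
      ContinuousLinearMap.adjoint_inner_left]

/-- The regular representation induced from the GNS representation of `f`. -/
def regularRep (f : A →ₚ[ℂ] ℂ) (hf : f 1 = 1) (α : A ≃⋆ₐ[ℂ] A) : CovariantRep α where
  H := RegularSpace f
  nontrivial := by
    refine ⟨lp.single 2 0 (cyclicVector f), 0, fun h => ?_⟩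
    have h1 := congrArg (fun x : RegularSpace f => x 0) h
    simp only [lp.single_apply_self] at h1
    have h2 := norm_cyclicVector_sq f
    rw [h1, hf] at h2
    simp at h2
  π := regularHom f α
  U := Unitary.linearIsometryEquiv.symm (shift f)
  covariant a := by
    ext x k
    change f.gnsStarAlgHom ((α ^ (-(k - 1))) a) (x (k - 1))
      = f.gnsStarAlgHom ((α ^ (-k)) (α a)) (x (k - 1))
    rw [neg_sub, sub_eq_add_neg, add_comm, zpow_add_one]
    rfl

theorem shift_single (f : A →ₚ[ℂ] ℂ) (n : ℤ) (v : f.GNS) :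
    shift f (lp.single 2 n v) = lp.single 2 (n + 1) v := by
  ext1; funext k
  change (lp.single 2 n v : RegularSpace f) (k - 1) = (lp.single 2 (n + 1) v : RegularSpace f) k
  rw [lp.single_apply, lp.single_apply, Pi.single_apply, Pi.single_apply]
  simp [sub_eq_iff_eq_add]

theorem shift_zpow (f : A →ₚ[ℂ] ℂ) (n : ℤ) (v : f.GNS) :
    (shift f ^ n) (lp.single 2 0 v) = lp.single 2 n v := by
  induction n with
  | zero => simp
  | succ n ih =>
    rw [add_comm, zpow_add, zpow_one, LinearIsometryEquiv.coe_mul, Function.comp_apply, ih, shift_single, add_comm]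
  | pred n ih =>
    rw [sub_eq_add_neg, add_comm, zpow_add, zpow_neg_one, LinearIsometryEquiv.coe_mul, Function.comp_apply, ih]
    apply (shift f).injective
    rw [shift_single]
    change shift f ((shift f).symm _) = _
    rw [LinearIsometryEquiv.apply_symm_apply]
    congr 1
    ring

/-- The vector `ξ_f ⊗ δ_0`. -/
def regularVector (f : A →ₚ[ℂ] ℂ) (hf : f 1 = 1) (α : A ≃⋆ₐ[ℂ] A) : (regularRep f hf α).H :=
  (lp.single 2 0 (cyclicVector f) : RegularSpace f)

open CrossedProduct in
theorem regularRep_vector (f : A →ₚ[ℂ] ℂ) (hf : f 1 = 1) (α : A ≃⋆ₐ[ℂ] A) (a : A) (n : ℤ) :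
    vectorFunctional (regularRep f hf α) (regularVector f hf α) (ι α a * (V α ^ n).1)
      = if n = 0 then f a else 0 := by
  have h0 : eval (regularRep f hf α) (V α ^ n).1
      = ((Unitary.linearIsometryEquiv.symm (shift f) ^ n : unitary _) :
          RegularSpace f →L[ℂ] RegularSpace f) := by
    have := map_zpow (Unitary.map (StarMonoidHom.ofClass (eval (regularRep f hf α)))) (V α) n
    exact congrArg Subtype.val this
  have h1 : eval (regularRep f hf α) (V α ^ n).1 (regularVector f hf α)
      = (lp.single 2 n (cyclicVector f) : RegularSpace f) := by
    rw [h0, ← map_zpow]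
    exact shift_zpow f n _
  have h2 : eval (regularRep f hf α) (ι α a * (V α ^ n).1) (regularVector f hf α)
      = regularHom f α a (lp.single 2 n (cyclicVector f) : RegularSpace f) := by
    rw [map_mul]
    exact congrArg (regularHom f α a) h1
  rw [vectorFunctional_apply, h2]
  change (inner ℂ (lp.single 2 0 (cyclicVector f) : RegularSpace f)
    (regularHom f α a (lp.single 2 n (cyclicVector f) : RegularSpace f)) : ℂ) = _
  rw [lp.inner_single_left]
  change (inner ℂ (cyclicVector f) (f.gnsStarAlgHom ((α ^ (-0 : ℤ)) a)
    ((lp.single 2 n (cyclicVector f) : RegularSpace f) 0)) : ℂ) = _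
  split_ifs with h
  · subst h
    rw [lp.single_apply_self, neg_zero, zpow_zero, StarAlgEquiv.one_apply,
      gnsStarAlgHom_cyclicVector, cyclicVector, UniformSpace.Completion.inner_coe,
      PositiveLinearMap.preGNS_inner_def]
    simp
  · rw [lp.single_apply_ne _ _ _ (Ne.symm h)]
    simp

end Regular

namespace CrossedProduct

section Embedding
variable {A : Type u} [CStarAlgebra A] (α : A ≃⋆ₐ[ℂ] A)

theorem ι_injective : Function.Injective (ι α) := by
  let _ : PartialOrder A := CStarAlgebra.spectralOrder A
  have : StarOrderedRing A := CStarAlgebra.spectralOrderedRing A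
  rw [injective_iff_map_eq_zero]
  intro a ha
  by_contra hne
  obtain ⟨f, hf, hf1⟩ := exists_state_ne_zero (star_mul_self_nonneg a)
    (by simpa using hne)
  apply hf
  have h := regularRep_vector f hf1 α (star a * a) 0
  rw [if_pos rfl, map_mul (ι α), ha, mul_zero, zero_mul, map_zero] at h
  exact h.symm

theorem norm_ι (a : A) : ‖ι α a‖ = ‖a‖ := NonUnitalStarAlgHom.norm_map (ι α) (ι_injective α) a

end Embedding

section Expectation
variable {A : Type u} [CStarAlgebra A] {α : A ≃⋆ₐ[ℂ] A}

theorem continuous_gauge_exp (x : CrossedProduct α) :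
    Continuous fun t : ℝ => gauge α (Circle.exp t) x :=
  (continuous_gauge x).comp Circle.exp.continuous

variable (α) in
/-- The average `(1/2π) ∫_0^{2π} ρ_{exp(it)}(x) dt` of the gauge action. -/
def gaugeAverage : CrossedProduct α →L[ℂ] CrossedProduct α :=
  LinearMap.mkContinuous
    { toFun := fun x => (2 * Real.pi)⁻¹ • ∫ t in (0 : ℝ)..(2 * Real.pi), gauge α (Circle.exp t) x
      map_add' := fun x y => by
        simp only [map_add]
        rw [intervalIntegral.integral_add ((continuous_gauge_exp x).intervalIntegrable _ _)
          ((continuous_gauge_exp y).intervalIntegrable _ _), smul_add]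
      map_smul' := fun c x => by
        simp only [map_smul, RingHom.id_apply]
        rw [intervalIntegral.integral_smul, smul_comm] } 1 (fun x => by
      have h := intervalIntegral.norm_integral_le_of_norm_le_const (a := 0) (b := 2 * Real.pi)
        (f := fun t => gauge α (Circle.exp t) x) (C := ‖x‖) fun t _ => gauge_norm_le _ x
      have hpi : 0 < 2 * Real.pi := by positivity
      rw [sub_zero, abs_of_pos hpi] at h
      change ‖(2 * Real.pi)⁻¹ • ∫ t in (0 : ℝ)..(2 * Real.pi), gauge α (Circle.exp t) x‖ ≤ _
      rw [norm_smul, Real.norm_of_nonneg (by positivity), one_mul, inv_mul_le_iff₀ hpi]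
      linarith)

theorem gaugeAverage_apply (x : CrossedProduct α) : gaugeAverage α x
    = (2 * Real.pi)⁻¹ • ∫ t in (0 : ℝ)..(2 * Real.pi), gauge α (Circle.exp t) x := rfl

theorem gaugeAverage_gen (a : A) (n : ℤ) :
    gaugeAverage α (ι α a * (V α ^ n).1) = if n = 0 then ι α a else 0 := by
  rw [gaugeAverage_apply]
  simp only [gauge_zpow]
  rw [intervalIntegral.integral_smul_const]
  split_ifs with h
  · subst h
    simp only [zpow_zero, Circle.coe_one, Submonoid.coe_one, mul_one]
    rw [intervalIntegral.integral_const, sub_zero, ← Complex.coe_smul, smul_smul]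
    have : ((2 * Real.pi)⁻¹ : ℝ) * ((2 * Real.pi) • (1 : ℂ)) = 1 := by
      have hpi : (Real.pi : ℂ) ≠ 0 := by exact_mod_cast Real.pi_ne_zero
      simp
      field_simp
    rw [this, one_smul]
  · have : ∫ t in (0 : ℝ)..(2 * Real.pi), ((Circle.exp t ^ n : Circle) : ℂ) = 0 := by
      have h1 : ∀ t : ℝ, ((Circle.exp t ^ n : Circle) : ℂ) = Complex.exp ((n * Complex.I) * t) := by
        intro t
        rw [Circle.coe_zpow, Circle.coe_exp, ← Complex.exp_int_mul]
        congr 1; ring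
      simp only [h1]
      rw [integral_exp_mul_complex (mul_ne_zero (by exact_mod_cast h) Complex.I_ne_zero)]
      have : Complex.exp (n * Complex.I * ((2 * Real.pi : ℝ) : ℂ)) = 1 := by
        rw [Complex.exp_eq_one_iff]
        exact ⟨n, by push_cast; ring⟩
      rw [this]; simp
    rw [this, zero_smul, smul_zero]

theorem gaugeAverage_mem_range (x : CrossedProduct α) :
    gaugeAverage α x ∈ LinearMap.range (ι α).toAlgHom.toLinearMap := by
  have hcl : IsClosed (Set.range (ι α)) :=
    (AddMonoidHomClass.isometry_of_norm (ι α) (norm_ι α)).isClosedEmbedding.isClosed_range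
  refine induction
    (p := fun x => gaugeAverage α x ∈ LinearMap.range (ι α).toAlgHom.toLinearMap)
    (hcl.preimage (gaugeAverage α).continuous) ?_ ?_ ?_ ?_ x
  · rw [map_zero]; exact Submodule.zero_mem _
  · intro x y hx hy; rw [map_add]; exact Submodule.add_mem _ hx hy
  · intro c x hx; rw [map_smul]; exact Submodule.smul_mem _ c hx
  · intro a n
    rw [gaugeAverage_gen]
    split_ifs
    · exact ⟨a, rfl⟩
    · exact Submodule.zero_mem _

variable (α) in
/-- The canonical conditional expectation `E : A ⋊_α ℤ → A`, that is the gauge average read in `A`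
(see `ι_condExp`). -/
def condExp : CrossedProduct α →ₗ[ℂ] A :=
  (LinearEquiv.ofInjective (ι α).toAlgHom.toLinearMap (ι_injective α)).symm.toLinearMap ∘ₗ
    (gaugeAverage α).toLinearMap.codRestrict _ gaugeAverage_mem_range

theorem ι_condExp (x : CrossedProduct α) : ι α (condExp α x) = gaugeAverage α x :=
  congrArg Subtype.val ((LinearEquiv.ofInjective (ι α).toAlgHom.toLinearMap
    (ι_injective α)).apply_symm_apply ⟨gaugeAverage α x, gaugeAverage_mem_range x⟩)

theorem condExp_gen (a : A) (n : ℤ) :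
    condExp α (ι α a * (V α ^ n).1) = if n = 0 then a else 0 := by
  apply ι_injective α
  rw [ι_condExp, gaugeAverage_gen]
  split_ifs <;> simp

theorem condExp_ι (a : A) : condExp α (ι α a) = a := by
  simpa using condExp_gen (α := α) a 0

theorem continuous_condExp : Continuous (condExp α) := by
  refine AddMonoidHomClass.continuous_of_bound (condExp α) ‖gaugeAverage α‖ fun x => ?_
  rw [← norm_ι α, ι_condExp]
  exact (gaugeAverage α).le_opNorm x

theorem condExp_skewAut (θ : A ≃⋆ₐ[ℂ] A) (w : unitary A)
    (h : ∀ a, (w : A) * α (θ a) = θ (α a) * w) (x : CrossedProduct α) :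
    condExp α (skewAut θ w h x) = θ (condExp α x) := by
  apply ι_injective α
  rw [ι_condExp]
  have h1 : ι α (θ (condExp α x)) = skewAut θ w h (ι α (condExp α x)) := rfl
  rw [h1, ι_condExp]
  have hcomm : ∀ z : Circle, gauge α z (skewAut θ w h x) = skewAut θ w h (gauge α z x) := by
    intro z
    refine hom_ext (φ := (gauge α z).comp (skewEnd (θ : A →⋆ₐ[ℂ] A) w h))
      (ψ := (skewEnd (θ : A →⋆ₐ[ℂ] A) w h).comp (gauge α z)) (fun a => rfl) ?_ x
    change gauge α z (ι α w * (V α).1) = skewEnd (θ : A →⋆ₐ[ℂ] A) w h (gauge α z (V α).1)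
    rw [map_mul, gauge_V, map_smul, gauge_ι, mul_smul_comm]
    rfl
  rw [gaugeAverage_apply, gaugeAverage_apply]
  simp only [hcomm]
  let L : CrossedProduct α →L[ℂ] CrossedProduct α :=
    ⟨(skewEnd (θ : A →⋆ₐ[ℂ] A) w h).toAlgHom.toLinearMap,
      map_continuous (skewEnd (θ : A →⋆ₐ[ℂ] A) w h)⟩
  have h2 := L.intervalIntegral_comp_comm
    ((continuous_gauge_exp x).intervalIntegrable (μ := MeasureTheory.volume) 0 (2 * Real.pi))
  change (2 * Real.pi)⁻¹ • ∫ t in (0 : ℝ)..(2 * Real.pi), L (gauge α (Circle.exp t) x)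
    = L ((2 * Real.pi)⁻¹ • ∫ t in (0 : ℝ)..(2 * Real.pi), gauge α (Circle.exp t) x)
  rw [h2, ← Complex.coe_smul, ← Complex.coe_smul, map_smul]

end Expectation

section InducedState
variable {A : Type u} [CStarAlgebra A] [PartialOrder A] [StarOrderedRing A]

theorem condExp_nonneg (α : A ≃⋆ₐ[ℂ] A) (f : A →ₚ[ℂ] ℂ) (hf : f 1 = 1) {x : CrossedProduct α} (hx : 0 ≤ x) : 0 ≤ f (condExp α x) := by
  have hrep : ∀ y : CrossedProduct α,
      vectorFunctional (regularRep f hf α) (regularVector f hf α) y = f (condExp α y) := by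
    intro y
    have hfc : Continuous f := map_continuous f
    refine induction (p := fun y =>
      vectorFunctional (regularRep f hf α) (regularVector f hf α) y = f (condExp α y))
      (isClosed_eq (continuous_vectorFunctional _ _) (hfc.comp continuous_condExp)) ?_ ?_ ?_ ?_ y
    · simp
    · intro y z hy hz
      rw [map_add, map_add, map_add, hy, hz]
    · intro c y hy
      rw [map_smul, map_smul, map_smul, hy]
    · intro a n
      rw [regularRep_vector, condExp_gen]
      split_ifs <;> simp
  rw [← hrep]
  exact vectorFunctional_nonneg _ _ hx

/-- The state `f ∘ E` on `A ⋊_α ℤ`, for a state `f` of `A`. -/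
def inducedState (α : A ≃⋆ₐ[ℂ] A) (f : A →ₚ[ℂ] ℂ) (hf : f 1 = 1) : CrossedProduct α →ₚ[ℂ] ℂ :=
  PositiveLinearMap.mk₀ (f.toLinearMap ∘ₗ condExp α) fun _ hx => condExp_nonneg α f hf hx

theorem inducedState_apply (α : A ≃⋆ₐ[ℂ] A) (f : A →ₚ[ℂ] ℂ) (hf : f 1 = 1)
    (x : CrossedProduct α) : inducedState α f hf x = f (condExp α x) := rfl

theorem inducedState_ι (α : A ≃⋆ₐ[ℂ] A) (f : A →ₚ[ℂ] ℂ) (hf : f 1 = 1) (a : A) :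
    inducedState α f hf (ι α a) = f a := by
  rw [inducedState_apply, condExp_ι]

/-- If `f` is `θ`-invariant then `f ∘ E` is `Φ_{θ,w}`-invariant. -/
theorem inducedState_skewAut (α : A ≃⋆ₐ[ℂ] A) (f : A →ₚ[ℂ] ℂ) (hf : f 1 = 1) (θ : A ≃⋆ₐ[ℂ] A)
    (w : unitary A) (h : ∀ a, (w : A) * α (θ a) = θ (α a) * w) (hθ : ∀ a, f (θ a) = f a)
    (x : CrossedProduct α) :
    inducedState α f hf (skewAut θ w h x) = inducedState α f hf x := by
  rw [inducedState_apply, condExp_skewAut, hθ, inducedState_apply]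

end InducedState
end CrossedProduct

section Main

/-- For a bounded operator `T` on a Hilbert space, the self-adjoint projection onto the closed
subspace of the vectors `x` with `T x = c x`. -/
def eigenProjection {H : Type u} [NormedAddCommGroup H] [InnerProductSpace ℂ H] [CompleteSpace H]
    (T : H →L[ℂ] H) (c : ℂ) : H →L[ℂ] H :=
  (T - c • (1 : H →L[ℂ] H)).ker.starProjection

variable {A : Type u} [CStarAlgebra A] [PartialOrder A] [StarOrderedRing A]

/-- The operator `V_{φ,Φ}` of the covariant GNS representation of a `*`-automorphism `Φ` and an
invariant positive functional `φ`: it is the bounded operator on `H_φ` with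
`V_{φ,Φ} (π_φ(a) ξ_φ) = π_φ(Φ a) ξ_φ`. -/
def covariantOperator (Φ : A ≃⋆ₐ[ℂ] A) (φ : A →ₚ[ℂ] ℂ) (h : ∀ a, φ (Φ a) = φ a) :
    φ.GNS →L[ℂ] φ.GNS :=
  gnsMap φ φ (Φ : A →⋆ₐ[ℂ] A) h

/-- Weak clustering: `(1/n) ∑_{k < n} φ(a Φ^k(b)) → φ(a) φ(b)` for all `a`, `b`. -/
def WeaklyClustering (Φ : A ≃⋆ₐ[ℂ] A) (φ : A →ₚ[ℂ] ℂ) : Prop :=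
  ∀ a b : A, Filter.Tendsto
    (fun n : ℕ => (n : ℂ)⁻¹ * ∑ k ∈ Finset.range n, φ (a * (Φ ^ k) b))
    Filter.atTop (nhds (φ a * φ b))

/-- The elements `u_n`: `u_n = u α(u) ⋯ α^{n-1}(u)` for `n ≥ 0` (so `u_0 = 1`), and
`u_n = α^{-1}(u*) α^{-2}(u*) ⋯ α^{n}(u*)` for `n < 0`. -/
def cocycle (α : A ≃⋆ₐ[ℂ] A) (u : unitary A) : ℤ → A
  | Int.ofNat n => ((List.range n).map fun k : ℕ => (α ^ k) (u : A)).prod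
  | Int.negSucc n =>
    ((List.range (n + 1)).map fun k : ℕ => (α ^ (-((k : ℤ) + 1))) (star (u : A))).prod

/-- The isometry `H_f → H_{f ∘ E}`, `π_f(a) ξ_f ↦ π_{f ∘ E}(a) ξ_{f ∘ E}`, that identifies `H_f`
with the closure of `π_{f ∘ E}(A) ξ_{f ∘ E}`. -/
def gnsInclusion (α : A ≃⋆ₐ[ℂ] A) (f : A →ₚ[ℂ] ℂ) (hf : f 1 = 1) :
    f.GNS →L[ℂ] (CrossedProduct.inducedState α f hf).GNS :=
  gnsMap f (CrossedProduct.inducedState α f hf) (CrossedProduct.ι α)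
    (CrossedProduct.inducedState_ι α f hf)

end Main

end SkewProduct

end

/-! The GNS space of `ω = ωo ∘ E` is a space of Fourier series over `ℤ` with coefficients in the GNS
space of `ωo`. Put `S_n = π_ω(V^n) J`, so that `S_0 = J`. Because `E` annihilates `a V^k` for `k ≠
0`, the `S_n` are isometries with mutually orthogonal ranges (`inner_fourierInclusion`). These
ranges are jointly total because the finite sums of the `V^n a` are dense
(`fourierInclusion_total`).

In this decomposition the operator `W` implementing `Φ = Φ_{θ,u}` is block diagonal. From `Φ(V^n) =
u_n V^n` (`skewAut_V_zpow`) follows `Φ(V^n a) = V^n α^{-n}(u_n) θ(a)`, that is `W S_n = S_n T_n`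
with `T_n = π(α^{-n}(u_n)) V_{ωo,θ}` (`covariantOperator_fourierInclusion`). Hence the fixed space
of `W` is the orthogonal sum of the spaces `S_n Fix(T_n)`. As `T_0 = V_{ωo,θ}`, the operator `J E_1
J*` is the projection onto the summand with `n = 0`. It equals the whole fixed projection of `W`
exactly when the other summands vanish (`conj_eigenProjection_eq_iff`, a statement about abstract
block operators).

For clustering, the mean ergodic theorem turns the limit of the correlation averages into a matrix
coefficient of the fixed projection, so weak clustering says that only multiples of the cyclic
vector are fixed (`weaklyClustering_iff`). The cyclic vector of `ω` lies in the block `n = 0`. If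
the base system is clustering, that block contributes only these multiples, and what remains is that
the other blocks contribute nothing. -/

namespace SkewProduct

/-! ### Fixed vectors of block diagonal operators -/

section Hilbert

variable {ι H K : Type*} [NormedAddCommGroup H] [InnerProductSpace ℂ H] [CompleteSpace H]
  [NormedAddCommGroup K] [InnerProductSpace ℂ K] [CompleteSpace K]
  [DecidableEq ι] {S : ι → H →L[ℂ] K} {T : ι → H →L[ℂ] H} {W : K →L[ℂ] K}

open ContinuousLinearMap in
theorem adjoint_apply_of_orthogonal
    (hS : ∀ m n x y, inner ℂ (S m x) (S n y) = if m = n then inner ℂ x y else 0) (m n : ι) (y : H) :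
    adjoint (S m) (S n y) = if m = n then y else 0 := by
  refine ext_inner_left ℂ fun x => ?_
  rw [adjoint_inner_right, hS]
  split_ifs <;> simp

open ContinuousLinearMap in
/-- If `W` acts on the ranges of the orthogonal isometries `S n` as `T n`, and these ranges are
total, then `S n` intertwines `W` and `T n` from the other side, too. -/
theorem adjoint_apply_intertwine
    (hS : ∀ m n x y, inner ℂ (S m x) (S n y) = if m = n then inner ℂ x y else 0)
    (htot : ∀ z, (∀ n x, inner ℂ (S n x) z = 0) → z = 0)
    (hW : ∀ n x, W (S n x) = S n (T n x)) (n : ι) (z : K) :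
    adjoint (S n) (W z) = T n (adjoint (S n) z) := by
  -- The defect `D` of the intertwining relation kills the range of every `S m`. So `D* D z` is
  -- orthogonal to all these ranges, hence zero, and `‖D z‖² = ⟪D* D z, z⟫ = 0`. No normality of `W`
  -- or `T n` enters.
  set D : K →L[ℂ] H := adjoint (S n) ∘L W - T n ∘L adjoint (S n) with hD
  have hDS : ∀ m x, D (S m x) = 0 := fun m x => by
    simp only [hD, sub_apply, comp_apply, hW, adjoint_apply_of_orthogonal hS]
    split_ifs with h <;> simp [h]
  have hDz : D z = 0 := by
    have h0 : adjoint D (D z) = 0 := htot _ fun m x => by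
      rw [adjoint_inner_right, hDS, inner_zero_left]
    rw [← inner_self_eq_zero (𝕜 := ℂ), ← adjoint_inner_left, h0, inner_zero_left]
  exact sub_eq_zero.1 hDz

open ContinuousLinearMap in
-- The components `S_n* z` of a fixed vector are fixed by the blocks `T n`, so only the component at
-- `i` survives and `z` lies in the range of `S i`.
theorem fixed_eq_of_no_fixed
    (hS : ∀ m n x y, inner ℂ (S m x) (S n y) = if m = n then inner ℂ x y else 0)
    (htot : ∀ z, (∀ n x, inner ℂ (S n x) z = 0) → z = 0)
    (hW : ∀ n x, W (S n x) = S n (T n x)) (i : ι)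
    (hT : ∀ n, n ≠ i → ∀ η, T n η = η → η = 0) {z : K} (hz : W z = z) :
    T i (adjoint (S i) z) = adjoint (S i) z ∧ S i (adjoint (S i) z) = z := by
  have hfix : ∀ n, T n (adjoint (S n) z) = adjoint (S n) z := fun n => by
    rw [← adjoint_apply_intertwine hS htot hW, hz]
  -- By totality it suffices that `S_i S_i* z` and `z` have the same component at each `n`.
  refine ⟨hfix i, sub_eq_zero.1 (htot _ fun n x => ?_)⟩
  rw [← adjoint_inner_right, map_sub, adjoint_apply_of_orthogonal hS]
  split_ifs with h
  · rw [h, sub_self, inner_zero_right]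
  · rw [hT n h _ (hfix n), sub_self, inner_zero_right]

omit [CompleteSpace H] in
theorem mem_ker_sub_smul_one {T : H →L[ℂ] H} {x : H} :
    x ∈ (T - (1 : ℂ) • (1 : H →L[ℂ] H)).ker ↔ T x = x := by
  simp [LinearMap.mem_ker, sub_eq_zero]

theorem map_eigenProjection_one {H : Type u} [NormedAddCommGroup H] [InnerProductSpace ℂ H]
    [CompleteSpace H] (T : H →L[ℂ] H) (x : H) :
    T (eigenProjection T 1 x) = eigenProjection T 1 x :=
  mem_ker_sub_smul_one.1 (Submodule.starProjection_apply_mem _ x)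

theorem eigenProjection_one_eq_self {H : Type u} [NormedAddCommGroup H] [InnerProductSpace ℂ H]
    [CompleteSpace H] {T : H →L[ℂ] H} {x : H} (hx : T x = x) : eigenProjection T 1 x = x :=
  Submodule.starProjection_eq_self_iff.2 (mem_ker_sub_smul_one.2 hx)

theorem inner_sub_eigenProjection_one {H : Type u} [NormedAddCommGroup H] [InnerProductSpace ℂ H]
    [CompleteSpace H] {T : H →L[ℂ] H} (x : H) {y : H} (hy : T y = y) :
    inner ℂ (x - eigenProjection T 1 x) y = 0 :=
  Submodule.starProjection_inner_eq_zero _ _ (mem_ker_sub_smul_one.2 hy)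

/-- Characterizes the projection of `x` as the fixed vector whose difference from `x` is orthogonal
to all fixed vectors; projections are computed below by guessing `y`. -/
theorem eigenProjection_one_eq {H : Type u} [NormedAddCommGroup H] [InnerProductSpace ℂ H]
    [CompleteSpace H] {T : H →L[ℂ] H} {x y : H} (hy : T y = y)
    (h : ∀ w, T w = w → inner ℂ (x - y) w = 0) : eigenProjection T 1 x = y :=
  Submodule.eq_starProjection_of_mem_of_inner_eq_zero (mem_ker_sub_smul_one.2 hy)
    fun w hw => h w (mem_ker_sub_smul_one.1 hw)

open ContinuousLinearMap in
-- The left side projects onto `S_i Fix(T_i)`, one of the orthogonal summands `S_n Fix(T_n)` of the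
-- fixed space of `W`.
theorem conj_eigenProjection_eq_iff {H : Type u} {K : Type v} [NormedAddCommGroup H]
    [InnerProductSpace ℂ H] [CompleteSpace H] [NormedAddCommGroup K] [InnerProductSpace ℂ K]
    [CompleteSpace K] {S : ι → H →L[ℂ] K} {T : ι → H →L[ℂ] H} {W : K →L[ℂ] K}
    (hS : ∀ m n x y, inner ℂ (S m x) (S n y) = if m = n then inner ℂ x y else 0)
    (htot : ∀ z, (∀ n x, inner ℂ (S n x) z = 0) → z = 0)
    (hW : ∀ n x, W (S n x) = S n (T n x)) (i : ι) :
    S i ∘L eigenProjection (T i) 1 ∘L adjoint (S i) = eigenProjection W 1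
      ↔ ∀ n, n ≠ i → ∀ η, T n η = η → η = 0 := by
  constructor
  · intro h n hn η hη
    have h1 : W (S n η) = S n η := by rw [hW, hη]
    -- Being fixed by `W`, the vector `S n η` equals its image under the conjugated projection,
    -- which begins with `S_i* S_n = 0`.
    have h2 : S n η = 0 := by
      rw [← eigenProjection_one_eq_self h1, ← h, comp_apply, comp_apply,
        adjoint_apply_of_orthogonal hS, if_neg hn.symm, map_zero, map_zero]
    have h3 := adjoint_apply_of_orthogonal hS n n η
    rw [h2, map_zero, if_pos rfl] at h3
    exact h3.symm
  · intro h
    ext x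
    refine (eigenProjection_one_eq ?_ fun w hw => ?_).symm
    · rw [comp_apply, comp_apply, hW, map_eigenProjection_one]
    -- Every fixed `w` is `S_i (S_i* w)` with `S_i* w` fixed by `T i`, so orthogonality to `w`
    -- reduces to orthogonality inside the block `i`.
    · obtain ⟨h1, h2⟩ := fixed_eq_of_no_fixed hS htot hW i h hw
      rw [← h2, ← adjoint_inner_left, map_sub, comp_apply, comp_apply,
        adjoint_apply_of_orthogonal hS, if_pos rfl]
      exact inner_sub_eigenProjection_one _ h1

end Hilbert

/-! ### Density and inner products in the GNS space -/

section GNS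

variable {A : Type u} {B : Type v} [CStarAlgebra A] [PartialOrder A] [StarOrderedRing A]
  [CStarAlgebra B] [PartialOrder B] [StarOrderedRing B]

theorem denseRange_gns_cyclicVector (f : A →ₚ[ℂ] ℂ) :
    DenseRange fun a => f.gnsStarAlgHom a (cyclicVector f) := by
  simp only [gnsStarAlgHom_cyclicVector]
  exact UniformSpace.Completion.denseRange_coe.comp f.toPreGNS.surjective.denseRange
    (UniformSpace.Completion.continuous_coe _)

theorem inner_gns_cyclicVector (f : A →ₚ[ℂ] ℂ) (a b : A) :
    inner ℂ (f.gnsStarAlgHom a (cyclicVector f)) (f.gnsStarAlgHom b (cyclicVector f))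
      = f (star a * b) := by
  rw [gnsStarAlgHom_cyclicVector, gnsStarAlgHom_cyclicVector, UniformSpace.Completion.inner_coe,
    PositiveLinearMap.preGNS_inner_def]
  rfl

theorem gns_induction (f : A →ₚ[ℂ] ℂ) {p : f.GNS → Prop} (hp : IsClosed {x | p x})
    (h : ∀ a, p (f.gnsStarAlgHom a (cyclicVector f))) (x : f.GNS) : p x :=
  (denseRange_gns_cyclicVector f).induction_on x hp h

theorem gns_eq_zero (f : A →ₚ[ℂ] ℂ) {x : f.GNS}
    (h : ∀ a, inner ℂ (f.gnsStarAlgHom a (cyclicVector f)) x = 0) : x = 0 := by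
  refine inner_self_eq_zero (𝕜 := ℂ).1 (gns_induction f (p := fun y => inner ℂ y x = 0) ?_ h x)
  exact isClosed_eq (continuous_id.inner continuous_const) continuous_const

theorem gnsMap_cyclicVector (f : A →ₚ[ℂ] ℂ) (g : B →ₚ[ℂ] ℂ) (j : A →⋆ₐ[ℂ] B)
    (h : ∀ a, g (j a) = f a) : gnsMap f g j h (cyclicVector f) = cyclicVector g := by
  simpa only [map_one, one_apply_eq_self] using gnsMap_apply f g j h 1

/-- Norms are preserved on the dense orbit of the cyclic vector. The bound supplies the contraction
hypothesis of the mean ergodic theorem. -/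
theorem norm_gnsMap_le (f : A →ₚ[ℂ] ℂ) (g : B →ₚ[ℂ] ℂ) (j : A →⋆ₐ[ℂ] B)
    (h : ∀ a, g (j a) = f a) : ‖gnsMap f g j h‖ ≤ 1 := by
  refine ContinuousLinearMap.opNorm_le_bound _ zero_le_one fun x => ?_
  rw [one_mul]
  refine gns_induction f (p := fun x => ‖gnsMap f g j h x‖ ≤ ‖x‖) (isClosed_le (by fun_prop) (by fun_prop)) (fun a => le_of_eq ?_) x
  rw [gnsMap_apply, @norm_eq_sqrt_re_inner ℂ, @norm_eq_sqrt_re_inner ℂ, inner_gns_cyclicVector,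
    inner_gns_cyclicVector, ← map_star, ← map_mul, h]

end GNS

/-! ### Weak clustering through the mean ergodic theorem -/

section Ergodic

variable {A : Type u} [CStarAlgebra A] [PartialOrder A] [StarOrderedRing A]

theorem covariantOperator_apply (Φ : A ≃⋆ₐ[ℂ] A) (φ : A →ₚ[ℂ] ℂ) (h : ∀ a, φ (Φ a) = φ a) (a : A) :
    covariantOperator Φ φ h (φ.gnsStarAlgHom a (cyclicVector φ))
      = φ.gnsStarAlgHom (Φ a) (cyclicVector φ) :=
  gnsMap_apply φ φ (Φ : A →⋆ₐ[ℂ] A) h a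

theorem covariantOperator_iterate (Φ : A ≃⋆ₐ[ℂ] A) (φ : A →ₚ[ℂ] ℂ) (h : ∀ a, φ (Φ a) = φ a) (a : A)
    (k : ℕ) : (covariantOperator Φ φ h)^[k] (φ.gnsStarAlgHom a (cyclicVector φ))
      = φ.gnsStarAlgHom ((Φ ^ k) a) (cyclicVector φ) := by
  induction k with
  | zero => rfl
  | succ k ih => rw [Function.iterate_succ_apply', ih, covariantOperator_apply, pow_succ']; rfl

/-- The correlation averages converge, by the mean ergodic theorem. -/
theorem tendsto_correlation_average (Φ : A ≃⋆ₐ[ℂ] A) (φ : A →ₚ[ℂ] ℂ) (h : ∀ a, φ (Φ a) = φ a)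
    (a b : A) :
    Filter.Tendsto (fun n : ℕ => (n : ℂ)⁻¹ * ∑ k ∈ Finset.range n, φ (a * (Φ ^ k) b)) Filter.atTop
      (nhds (inner ℂ (φ.gnsStarAlgHom (star a) (cyclicVector φ))
        (eigenProjection (covariantOperator Φ φ h) 1 (φ.gnsStarAlgHom b (cyclicVector φ))))) := by
  have h1 := ContinuousLinearMap.tendsto_birkhoffAverage_orthogonalProjection
    (covariantOperator Φ φ h) (norm_gnsMap_le _ _ _ _) (φ.gnsStarAlgHom b (cyclicVector φ))
  -- The ergodic theorem projects onto the equalizer of the operator and `1`, whereas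
  -- `eigenProjection` uses the kernel of their difference; the two are matched by the
  -- characterization of the projected vector.
  have h2 : eigenProjection (covariantOperator Φ φ h) 1 (φ.gnsStarAlgHom b (cyclicVector φ))
      = (((covariantOperator Φ φ h).eqLocus (1 : φ.GNS →L[ℂ] φ.GNS)).orthogonalProjectionOnto
        (φ.gnsStarAlgHom b (cyclicVector φ)) : φ.GNS) := by
    refine eigenProjection_one_eq (Subtype.property
      (((covariantOperator Φ φ h).eqLocus (1 : φ.GNS →L[ℂ] φ.GNS)).orthogonalProjectionOnto
        (φ.gnsStarAlgHom b (cyclicVector φ)))) fun w hw => ?_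
    exact Submodule.starProjection_inner_eq_zero
      (K := (covariantOperator Φ φ h).eqLocus (1 : φ.GNS →L[ℂ] φ.GNS)) _ _ hw
  rw [h2]
  refine ((continuous_const.inner continuous_id).tendsto _ |>.comp h1).congr fun n => ?_
  simp only [Function.comp_apply, id_eq, birkhoffAverage, birkhoffSum, covariantOperator_iterate,
    inner_smul_right, inner_sum, inner_gns_cyclicVector, star_star]

theorem inner_cyclicVector_left (φ : A →ₚ[ℂ] ℂ) (a : A) :
    inner ℂ (cyclicVector φ) (φ.gnsStarAlgHom a (cyclicVector φ)) = φ a := by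
  simpa using inner_gns_cyclicVector φ 1 a

theorem inner_cyclicVector_right (φ : A →ₚ[ℂ] ℂ) (a : A) :
    inner ℂ (φ.gnsStarAlgHom (star a) (cyclicVector φ)) (cyclicVector φ) = φ a := by
  simpa using inner_gns_cyclicVector φ (star a) 1

/-- Weak clustering means that the fixed vectors are the multiples of the cyclic vector. -/
theorem weaklyClustering_iff (Φ : A ≃⋆ₐ[ℂ] A) (φ : A →ₚ[ℂ] ℂ) (h : ∀ a, φ (Φ a) = φ a)
    (hφ : φ 1 = 1) : WeaklyClustering Φ φ ↔ ∀ x, covariantOperator Φ φ h x = x →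
      x = (inner ℂ (cyclicVector φ) x : ℂ) • cyclicVector φ := by
  constructor
  · intro hc x hx
    have hE : eigenProjection (covariantOperator Φ φ h) 1 x
        = (inner ℂ (cyclicVector φ) x : ℂ) • cyclicVector φ := by
      refine gns_induction φ (p := fun x => eigenProjection (covariantOperator Φ φ h) 1 x
        = (inner ℂ (cyclicVector φ) x : ℂ) • cyclicVector φ)
        (isClosed_eq (by fun_prop) (by fun_prop)) (fun b => ?_) x
      refine sub_eq_zero.1 (gns_eq_zero φ fun a => ?_)
      -- The same averages have two limits, so the coefficient of the fixed projection between
      -- `π(a)ξ` and `π(b)ξ` is `φ(a*) φ(b)`, which is that of the rank one projection onto `ξ`.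
      have h1 := tendsto_nhds_unique (tendsto_correlation_average Φ φ h (star a) b) (hc (star a) b)
      rw [inner_sub_right, inner_smul_right, inner_cyclicVector_left, ← star_star a, h1,
        inner_cyclicVector_right, mul_comm, sub_self]
    rwa [eigenProjection_one_eq_self hx] at hE
  · intro hx a b
    have h1 := tendsto_correlation_average Φ φ h a b
    have hξ : covariantOperator Φ φ h (cyclicVector φ) = cyclicVector φ :=
      gnsMap_cyclicVector _ _ _ _
    have hξ1 : inner ℂ (cyclicVector φ) (cyclicVector φ) = (1 : ℂ) := by
      simpa [hφ] using inner_cyclicVector_left φ 1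
    -- All fixed vectors are multiples of the unit vector `ξ`, so the projection of `π(b)ξ` is `⟪ξ,
    -- π(b)ξ⟫ ξ = φ(b) ξ`.
    rw [eigenProjection_one_eq (y := φ b • cyclicVector φ) (by rw [map_smul, hξ]) fun w hw => by
      rw [hx w hw, inner_smul_right, inner_sub_left, inner_smul_left, hξ1, mul_one,
        ← inner_conj_symm (φ.gnsStarAlgHom b (cyclicVector φ)), inner_cyclicVector_left, sub_self, mul_zero],
      inner_smul_right, inner_cyclicVector_right, mul_comm] at h1
    exact h1

end Ergodic

/-! ### The cocycle and the powers of `V` -/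

section Skew

variable {A : Type u} [CStarAlgebra A]

namespace CrossedProduct

theorem coe_V_zpow_mul (α : A ≃⋆ₐ[ℂ] A) (m n : ℤ) :
    (V α ^ m).1 * (V α ^ n).1 = (V α ^ (m + n)).1 := by
  rw [zpow_add, Submonoid.coe_mul]

theorem star_coe_V_zpow (α : A ≃⋆ₐ[ℂ] A) (n : ℤ) : star (V α ^ n).1 = (V α ^ (-n)).1 := by
  rw [zpow_neg]; rfl

theorem zpow_neg_apply_zpow_apply (α : A ≃⋆ₐ[ℂ] A) (n : ℤ) (a : A) :
    (α ^ n) ((α ^ (-n)) a) = a := by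
  rw [← StarAlgEquiv.mul_apply, ← zpow_add, add_neg_cancel, zpow_zero, StarAlgEquiv.one_apply]

theorem ι_mul_V_zpow_eq (α : A ≃⋆ₐ[ℂ] A) (n : ℤ) (a : A) :
    ι α a * (V α ^ n).1 = (V α ^ n).1 * ι α ((α ^ (-n)) a) := by
  rw [ι_mul_V_zpow, zpow_neg_apply_zpow_apply]

theorem cocycle_natCast_succ (α : A ≃⋆ₐ[ℂ] A) (u : unitary A) (n : ℕ) :
    cocycle α u ((n + 1 : ℕ) : ℤ) = cocycle α u (n : ℤ) * (α ^ n) (u : A) := by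
  change ((List.range (n + 1)).map fun k : ℕ => (α ^ k) (u : A)).prod = _
  rw [List.range_succ, List.map_append, List.prod_append]
  simp [cocycle]

theorem cocycle_neg_succ (α : A ≃⋆ₐ[ℂ] A) (u : unitary A) (n : ℕ) :
    cocycle α u (-((n + 1 : ℕ) : ℤ))
      = cocycle α u (-(n : ℤ)) * (α ^ (-((n + 1 : ℕ) : ℤ))) (star (u : A)) := by
  -- The product formula for negative indices also holds at `n = 0`, where it is empty. This merges
  -- the two constructors of `ℤ`, since `-(n + 1)` is `Int.negSucc n`.
  have h : ∀ n : ℕ, cocycle α u (-(n : ℤ))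
      = ((List.range n).map fun k : ℕ => (α ^ (-((k : ℤ) + 1))) (star (u : A))).prod := by
    rintro (_ | n)
    · rfl
    · rfl
  rw [h, h, List.range_succ, List.map_append, List.prod_append]
  simp

/-- This is what the `u_n` are made for: moving `V^n` past the next factor turns `u_n V^n · u V`
into `u_n α^n(u) V^{n+1}`. Downwards, `Φ(V⁻¹) = V⁻¹ u*` contributes the factor `α^{-(n+1)}(u*)`. -/
theorem skewAut_V_zpow (α θ : A ≃⋆ₐ[ℂ] A) (u : unitary A)
    (hu : ∀ a : A, (u : A) * α (θ a) = θ (α a) * (u : A)) (n : ℤ) :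
    skewAut θ u hu (V α ^ n).1 = ι α (cocycle α u n) * (V α ^ n).1 := by
  have hV : skewAut θ u hu (V α).1 = ι α u * (V α).1 := rfl
  obtain ⟨n, rfl | rfl⟩ := n.eq_nat_or_neg
  · induction n with
    | zero => simp [cocycle]
    | succ n ih =>
      rw [Nat.cast_succ, ← coe_V_zpow_mul, map_mul, ih, zpow_one, hV, ← Nat.cast_succ,
        cocycle_natCast_succ, map_mul, mul_assoc, ← mul_assoc (V α ^ (n : ℤ)).1, ι_mul_V_zpow]
      simp only [mul_assoc, zpow_natCast]
  · induction n with
    | zero => simp [cocycle]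
    | succ n ih =>
      have h1 : skewAut θ u hu (V α ^ (-1 : ℤ)).1 = (V α ^ (-1 : ℤ)).1 * ι α (star (u : A)) := by
        rw [← star_coe_V_zpow, zpow_one, map_star, hV, star_mul, map_star]
      have h2 : -((n + 1 : ℕ) : ℤ) = -(n : ℤ) + -1 := by push_cast; ring
      rw [cocycle_neg_succ, h2, ← coe_V_zpow_mul, map_mul, ih, h1, map_mul, mul_assoc, mul_assoc,
        ← mul_assoc (V α ^ (-(n : ℤ))).1, coe_V_zpow_mul, ι_mul_V_zpow]

end CrossedProduct

open CrossedProduct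

/-! ### Fourier decomposition of the GNS space of the induced state -/

variable [PartialOrder A] [StarOrderedRing A]

/-- The isometry `π_f(a) ξ_f ↦ π_{f ∘ E}(V^n a) ξ_{f ∘ E}`. -/
noncomputable def fourierInclusion (α : A ≃⋆ₐ[ℂ] A) (f : A →ₚ[ℂ] ℂ) (hf : f 1 = 1) (n : ℤ) :
    f.GNS →L[ℂ] (inducedState α f hf).GNS :=
  (inducedState α f hf).gnsStarAlgHom (V α ^ n).1 ∘L gnsInclusion α f hf

theorem fourierInclusion_zero (α : A ≃⋆ₐ[ℂ] A) (f : A →ₚ[ℂ] ℂ) (hf : f 1 = 1) :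
    fourierInclusion α f hf 0 = gnsInclusion α f hf := by
  rw [fourierInclusion, zpow_zero, Submonoid.coe_one, map_one]
  rfl

theorem fourierInclusion_apply (α : A ≃⋆ₐ[ℂ] A) (f : A →ₚ[ℂ] ℂ) (hf : f 1 = 1) (n : ℤ) (a : A) :
    fourierInclusion α f hf n (f.gnsStarAlgHom a (cyclicVector f))
      = (inducedState α f hf).gnsStarAlgHom ((V α ^ n).1 * ι α a)
        (cyclicVector (inducedState α f hf)) := by
  rw [map_mul, fourierInclusion, gnsInclusion, ContinuousLinearMap.comp_apply, gnsMap_apply]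
  rfl

theorem inner_fourierInclusion (α : A ≃⋆ₐ[ℂ] A) (f : A →ₚ[ℂ] ℂ) (hf : f 1 = 1) (m n : ℤ)
    (x y : f.GNS) : inner ℂ (fourierInclusion α f hf m x) (fourierInclusion α f hf n y)
      = if m = n then inner ℂ x y else 0 := by
  refine gns_induction f (p := fun x => inner ℂ (fourierInclusion α f hf m x)
    (fourierInclusion α f hf n y) = if m = n then inner ℂ x y else 0) ?_ (fun a => ?_) x
  · split_ifs <;> exact isClosed_eq (by fun_prop) (by fun_prop)
  refine gns_induction f (p := fun y => inner ℂ (fourierInclusion α f hf m _)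
    (fourierInclusion α f hf n y) = if m = n then inner ℂ _ y else 0) ?_ (fun b => ?_) y
  · split_ifs <;> exact isClosed_eq (by fun_prop) (by fun_prop)
  -- The inner product is `ω(a* V^{n-m} b) = ω(a* α^{n-m}(b) V^{n-m})`, which `E` kills unless `m =
  -- n`.
  rw [fourierInclusion_apply, fourierInclusion_apply, inner_gns_cyclicVector,
    inner_gns_cyclicVector, star_mul, star_coe_V_zpow, mul_assoc, ← mul_assoc (V α ^ (-m)).1,
    coe_V_zpow_mul, ι_mul_V_zpow, ← mul_assoc, ← map_star, ← map_mul, inducedState_apply,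
    condExp_gen]
  by_cases h : m = n
  · subst h; simp
  · rw [if_neg h, if_neg (by omega), map_zero]

theorem fourierInclusion_total (α : A ≃⋆ₐ[ℂ] A) (f : A →ₚ[ℂ] ℂ) (hf : f 1 = 1)
    (z : (inducedState α f hf).GNS) (hz : ∀ n x, inner ℂ (fourierInclusion α f hf n x) z = 0) :
    z = 0 := by
  have hc : Continuous (inducedState α f hf).gnsStarAlgHom := map_continuous _
  refine gns_eq_zero _ fun x => ?_
  refine CrossedProduct.induction (p := fun x => inner ℂ ((inducedState α f hf).gnsStarAlgHom x
    (cyclicVector (inducedState α f hf))) z = 0) ?_ ?_ ?_ ?_ ?_ x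
  · exact isClosed_eq ((hc.clm_apply continuous_const).inner continuous_const) continuous_const
  · simp
  · intro x y hx hy
    rw [map_add, add_apply, inner_add_left, hx, hy, add_zero]
  · intro c x hx
    rw [map_smul, smul_apply, inner_smul_left, hx, mul_zero]
  · intro a n
    -- Writing `a V^n = V^n α^{-n}(a)` puts the generator's vector in the range of the `n`-th
    -- inclusion.
    rw [ι_mul_V_zpow_eq, ← fourierInclusion_apply, hz]

/-- On the orbit of the cyclic vector this is `Φ(V^n a) = u_n V^n θ(a) = V^n α^{-n}(u_n) θ(a)`;
moving `u_n` to the right of `V^n` produces the twist `α^{-n}`. -/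
theorem covariantOperator_fourierInclusion (θ α : A ≃⋆ₐ[ℂ] A) (u : unitary A)
    (hu : ∀ a : A, (u : A) * α (θ a) = θ (α a) * (u : A))
    (f : A →ₚ[ℂ] ℂ) (hf : f 1 = 1) (hθ : ∀ a : A, f (θ a) = f a) (n : ℤ) (x : f.GNS) :
    covariantOperator (skewAut θ u hu) (inducedState α f hf)
        (inducedState_skewAut α f hf θ u hu hθ) (fourierInclusion α f hf n x)
      = fourierInclusion α f hf n ((f.gnsStarAlgHom ((α ^ (-n)) (cocycle α u n))
          ∘L covariantOperator θ f hθ) x) := by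
  refine gns_induction f (p := fun x => covariantOperator (skewAut θ u hu) (inducedState α f hf)
      (inducedState_skewAut α f hf θ u hu hθ) (fourierInclusion α f hf n x)
    = fourierInclusion α f hf n ((f.gnsStarAlgHom ((α ^ (-n)) (cocycle α u n))
      ∘L covariantOperator θ f hθ) x))
    (isClosed_eq (by fun_prop) (by fun_prop)) (fun a => ?_) x
  rw [fourierInclusion_apply, covariantOperator_apply, ContinuousLinearMap.comp_apply,
    covariantOperator_apply, ← mul_apply_eq_comp, ← map_mul, fourierInclusion_apply,
    map_mul, skewAut_V_zpow, ι_mul_V_zpow_eq, map_mul (ι α), mul_assoc]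
  rfl

end Skew

end SkewProduct

/-! ### The equivalence and its consequence for clustering -/

open SkewProduct SkewProduct.CrossedProduct in
theorem mainTheorem4 {A : Type u} [CStarAlgebra A] [PartialOrder A] [StarOrderedRing A]
    (θ α : A ≃⋆ₐ[ℂ] A) (u : unitary A)
    (hu : ∀ a : A, (u : A) * α (θ a) = θ (α a) * (u : A))
    (ωo : A →ₚ[ℂ] ℂ) (hωo : ωo 1 = 1) (hθ : ∀ a : A, ωo (θ a) = ωo a) :
    (SkewProduct.gnsInclusion α ωo hωo
          ∘L SkewProduct.eigenProjection (SkewProduct.covariantOperator θ ωo hθ) 1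
          ∘L ContinuousLinearMap.adjoint (SkewProduct.gnsInclusion α ωo hωo)
        = SkewProduct.eigenProjection
            (SkewProduct.covariantOperator (SkewProduct.CrossedProduct.skewAut θ u hu)
              (SkewProduct.CrossedProduct.inducedState α ωo hωo)
              (SkewProduct.CrossedProduct.inducedState_skewAut α ωo hωo θ u hu hθ)) 1
      ↔ ∀ n : ℤ, n ≠ 0 → ∀ η : ωo.GNS,
          ωo.gnsStarAlgHom ((α ^ (-n)) (SkewProduct.cocycle α u n))
            (SkewProduct.covariantOperator θ ωo hθ η) = η → η = 0) ∧
    (SkewProduct.WeaklyClustering θ ωo →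
      (SkewProduct.WeaklyClustering (SkewProduct.CrossedProduct.skewAut θ u hu)
          (SkewProduct.CrossedProduct.inducedState α ωo hωo)
        ↔ ∀ n : ℤ, n ≠ 0 → ∀ η : ωo.GNS,
          ωo.gnsStarAlgHom ((α ^ (-n)) (SkewProduct.cocycle α u n))
            (SkewProduct.covariantOperator θ ωo hθ η) = η → η = 0)) := by
  have hS := inner_fourierInclusion α ωo hωo
  have htot := fourierInclusion_total α ωo hωo
  have hW := covariantOperator_fourierInclusion θ α u hu ωo hωo hθ
  -- As `u_0 = 1`, the block at `0` is the operator of the base system.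
  have hT0 : ωo.gnsStarAlgHom ((α ^ (-(0 : ℤ))) (cocycle α u 0)) ∘L covariantOperator θ ωo hθ
      = covariantOperator θ ωo hθ := by
    rw [show cocycle α u 0 = 1 from rfl, map_one, map_one]; rfl
  constructor
  · have h := conj_eigenProjection_eq_iff hS htot hW 0
    rw [hT0, fourierInclusion_zero] at h
    exact h
  · intro hc
    have hJξ : fourierInclusion α ωo hωo 0 (cyclicVector ωo)
        = cyclicVector (inducedState α ωo hωo) := by
      rw [fourierInclusion_zero]; exact gnsMap_cyclicVector _ _ _ _
    rw [weaklyClustering_iff θ ωo hθ hωo] at hc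
    rw [weaklyClustering_iff _ _ (inducedState_skewAut α ωo hωo θ u hu hθ)
      (by rw [← map_one (ι α), inducedState_ι, hωo])]
    constructor
    · intro h n hn η hη
      -- The vector `S_n η` is fixed, hence a multiple of the cyclic vector. The latter lies in the
      -- block `0`, so the coefficient vanishes, and `S_n η = 0` forces `η = 0`.
      have h1 := h (fourierInclusion α ωo hωo n η)
        ((hW n η).trans (congrArg (fourierInclusion α ωo hωo n) hη))
      rw [← hJξ, hS, if_neg hn.symm, zero_smul] at h1
      have h2 := hS n n η η
      rw [h1, inner_zero_left, if_pos rfl] at h2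
      exact inner_self_eq_zero.1 h2.symm
    · intro h x hx
      -- A fixed `x` comes from a vector of the base space fixed by `V_{ωo,θ}`. Clustering of the
      -- base makes that a multiple of `ξ_{ωo}`, which `J` carries to a multiple of `ξ_ω`.
      obtain ⟨h1, h2⟩ := fixed_eq_of_no_fixed hS htot hW 0 h hx
      rw [hT0] at h1
      rw [← h2, ← hJξ, hS, if_pos rfl, ← map_smul, ← hc _ h1]
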